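/- Let $1<p<\infty$ and let $\ell^p$ be the space of complex sequences $a=(a_n)_{n\in\mathbb Z}$ with $\|a\|_{\ell^p}=\big(\sum_{n\in\mathbb Z}|a_n|^p\big)^{1/p}<\infty$. For $a\in\ell^p$ and $m\in\mathbb Z$ put $$(Ha)_m=\frac1\pi\sum_{n\in\mathbb Z,\ n\ne m}\frac{a_n}{m-n},\qquad (T_{1/2}\,a)_m=\frac1\pi\sum_{n\in\mathbb Z}\frac{a_n}{m-n+\frac12},$$ $$(Ka)_m=\frac2\pi\sum_{n\text{ even}}\frac{a_n}{m-n}\ \text{ if } m \text{ is odd},\qquad (Ka)_m=\frac2\pi\sum_{n\text{ odd}}\frac{a_n}{m-n}\ \text{ if } m\text{ is even},$$ and let $\widetilde K=2H-K$. Then $H$, $K$, $T_{1/2}$ (and hence $\widetilde K$) are bounded linear operators on $\ell^p$, and their operator norms $|||\cdot|||_{\ell^p}$ from $\ell^p$ to $\ell^p$ satisfy $$|||\widetilde K|||_{\ell^p}=|||H|||_{\ell^p}\qquad\text{and}\qquad |||H|||_{\ell^p}\le|||K|||_{\ell^p}=|||T_{1/2}|||_{\ell^p}.$$ -/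

import Mathlib

open scoped ENNReal

noncomputable section

/-- The discrete Hilbert transform `(H a)_m = (1/π) ∑_{n ≠ m} a_n / (m - n)`.
For `a ∈ ℓ^p` with `1 < p < ∞` the series converges absolutely, by Hölder's inequality. -/
def discreteHilbert (a : ℤ → ℂ) (m : ℤ) : ℂ :=
  (1 / (Real.pi : ℂ)) * ∑' n : {n : ℤ // n ≠ m}, a n / ((m : ℂ) - ((n : ℤ) : ℂ))

open Classical in
/-- The Kak-Hilbert transform: `(K a)_k` is `(2/π) ∑ a_n / (k - n)`, where the sum is over the
even integers `n` if `k` is odd, and over the odd integers `n` if `k` is even. -/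
def kakHilbert (a : ℤ → ℂ) (k : ℤ) : ℂ :=
  if Odd k then
    (2 / (Real.pi : ℂ)) * ∑' n : {n : ℤ // Even n}, a n / ((k : ℂ) - ((n : ℤ) : ℂ))
  else
    (2 / (Real.pi : ℂ)) * ∑' n : {n : ℤ // Odd n}, a n / ((k : ℂ) - ((n : ℤ) : ℂ))

open Classical in
/-- The family `T_t`, `t ∈ ℝ`: `(T_t a)_m = (sin (π t) / π) ∑_n a_n / (m - n + t)` if `t` is not an
integer, and `(T_t a)_m = (-1)^t a_{m+t}` if `t` is an integer (that is, if `t = ⌊t⌋`). -/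
def discreteT (t : ℝ) (a : ℤ → ℂ) (m : ℤ) : ℂ :=
  if t = (⌊t⌋ : ℝ) then
    (-1 : ℂ) ^ ⌊t⌋ * a (m + ⌊t⌋)
  else
    ((Real.sin (Real.pi * t) / Real.pi : ℝ) : ℂ) *
      ∑' n : ℤ, a n / ((m : ℂ) - (n : ℂ) + (t : ℂ))

/-- The complex sequence space `ℓ^p` over the integers. -/
abbrev EllP (p : ℝ≥0∞) := lp (fun _ : ℤ => ℂ) p

end

/-!
The operator `K` sends even positions to odd ones and odd positions to even ones, and on each parity
class it acts as `T_{1/2}`, because `2 / (2 l + 1 - 2 j) = 1 / (l - j + 1 / 2)`. Likewise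
`K̃ = 2 H - K` preserves parity and acts on each class as `H`, because `2 / (2 l - 2 j) = 1 / (l - j)`.
Up to isometric relabelling, `K` and `K̃` are thus the direct sums `T_{1/2} ⊕ T_{1/2}` and `H ⊕ H` on
`ℓ^p ⊕ ℓ^p` (`exists_interleave`), so that `‖K‖ = ‖T_{1/2}‖` and `‖K̃‖ = ‖H‖`. The inequality follows
from `2 H = K + K̃`: `2 ‖H‖ ≤ ‖K‖ + ‖K̃‖ = ‖K‖ + ‖H‖`.

The analytic content is M. Riesz's theorem that `H` is bounded on `ℓ^p` (`convBounded_one_div`), proved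
as a uniform bound for finite sections. For `1 < p ≤ 2` and `a ≥ 0` finitely supported, the function
`F z = i ∑ a_n / (z - n)` maps the upper half-plane to the right half-plane, where
`|Im w| ^ p ≤ A (Re w) ^ p - B Re (w ^ p)` (`exists_abs_im_rpow_le`). By Cauchy's theorem on large
rectangles and `F z = O(1 / |z|)`, the integral of `F ^ p` over the line `Im z = 1` vanishes
(`norm_integral_cauchySum_cpow_le`), so on that line `Im F` is controlled in `L^p` by `Re F`, a
convolution of `a` with an integrable positive kernel. At distance at most `1` from `m`, `Im F`
differs from `∑ a_n / (m - n)` by a convolution with a summable kernel (`abs_one_div_sub_le`), which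
Young's inequality bounds. The range `p ≥ 2` follows by duality (`ConvBounded.dual`), and `T_{1/2}`
differs from `H` by a convolution with a summable kernel (`convBounded_one_div_add_half`).
-/

/-! ### Kernels bounded on finite sections -/

/-- Convolution with the kernel `k` is bounded on real `ℓ^p`, expressed through the finite sections
`(k (m - n))_{m, n ∈ S}` with a constant that does not depend on the finite set `S`. -/
def ConvBounded (p : ℝ) (k : ℤ → ℝ) : Prop :=
  ∃ C, 0 ≤ C ∧ ∀ (S : Finset ℤ) (a : ℤ → ℝ),
    ∑ m ∈ S, |∑ n ∈ S, k (m - n) * a n| ^ p ≤ C * ∑ n ∈ S, |a n| ^ p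

theorem add_rpow_le_two_rpow_mul {p x y : ℝ} (hp : 0 ≤ p) (hx : 0 ≤ x) (hy : 0 ≤ y) :
    (x + y) ^ p ≤ 2 ^ p * (x ^ p + y ^ p) := by
  have key : ∀ u v : ℝ, 0 ≤ u → 0 ≤ v → u ≤ v → (u + v) ^ p ≤ 2 ^ p * (u ^ p + v ^ p) := by
    intro u v hu hv huv
    calc (u + v) ^ p ≤ (2 * v) ^ p := Real.rpow_le_rpow (by positivity) (by linarith) hp
      _ = 2 ^ p * v ^ p := Real.mul_rpow (by norm_num) hv
      _ ≤ _ := by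
        have := Real.rpow_nonneg hu p
        gcongr
        linarith
  rcases le_total x y with h | h
  · exact key x y hx hy h
  · have := key y x hy hx h
    rwa [add_comm y x, add_comm (y ^ p)] at this

theorem ConvBounded.add {p : ℝ} (hp : 0 ≤ p) {k l : ℤ → ℝ} (hk : ConvBounded p k)
    (hl : ConvBounded p l) : ConvBounded p (fun j => k j + l j) := by
  obtain ⟨C, hC, hk⟩ := hk
  obtain ⟨D, hD, hl⟩ := hl
  refine ⟨2 ^ p * (C + D), by positivity, fun S a => ?_⟩
  calc ∑ m ∈ S, |∑ n ∈ S, (k (m - n) + l (m - n)) * a n| ^ p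
      ≤ ∑ m ∈ S, 2 ^ p * (|∑ n ∈ S, k (m - n) * a n| ^ p + |∑ n ∈ S, l (m - n) * a n| ^ p) := by
        refine Finset.sum_le_sum fun m _ => ?_
        refine le_trans ?_ (add_rpow_le_two_rpow_mul hp (abs_nonneg _) (abs_nonneg _))
        simp only [add_mul, Finset.sum_add_distrib]
        exact Real.rpow_le_rpow (abs_nonneg _) (abs_add_le _ _) hp
    _ = 2 ^ p * (∑ m ∈ S, |∑ n ∈ S, k (m - n) * a n| ^ p
          + ∑ m ∈ S, |∑ n ∈ S, l (m - n) * a n| ^ p) := by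
        rw [← Finset.mul_sum, Finset.sum_add_distrib]
    _ ≤ 2 ^ p * (C * ∑ n ∈ S, |a n| ^ p + D * ∑ n ∈ S, |a n| ^ p) := by
        gcongr
        exacts [hk S a, hl S a]
    _ = _ := by ring

/-- Weighted Jensen inequality: `(∑ w f)^p ≤ (∑ w)^(p-1) ∑ w f^p`. -/
theorem sum_mul_rpow_le {ι : Type*} (s : Finset ι) {p : ℝ} (hp : 1 ≤ p) (w f : ι → ℝ)
    (hw : ∀ i, 0 ≤ w i) (hf : ∀ i, 0 ≤ f i) :
    (∑ i ∈ s, w i * f i) ^ p ≤ (∑ i ∈ s, w i) ^ (p - 1) * ∑ i ∈ s, w i * f i ^ p := by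
  have hp0 : p ≠ 0 := by linarith
  have hW : 0 ≤ ∑ i ∈ s, w i := Finset.sum_nonneg fun i _ => hw i
  have hF : 0 ≤ ∑ i ∈ s, w i * f i ^ p :=
    Finset.sum_nonneg fun i _ => mul_nonneg (hw i) (Real.rpow_nonneg (hf i) _)
  have h := Real.inner_le_weight_mul_Lp_of_nonneg s hp w f hw hf
  have h0 : 0 ≤ ∑ i ∈ s, w i * f i := Finset.sum_nonneg fun i _ => mul_nonneg (hw i) (hf i)
  refine (Real.rpow_le_rpow h0 h (by linarith)).trans (le_of_eq ?_)
  rw [Real.mul_rpow (by positivity) (by positivity), ← Real.rpow_mul hW, ← Real.rpow_mul hF,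
    inv_mul_cancel₀ hp0, Real.rpow_one]
  congr 2
  field_simp

/-- Young's inequality `‖w * a‖_p ≤ ‖w‖_1 ‖a‖_p` on finite sets of indices. -/
theorem sum_conv_rpow_le {p : ℝ} (hp : 1 ≤ p) {w : ℤ → ℝ} (hw : ∀ j, 0 ≤ w j)
    (hs : Summable w) (R S : Finset ℤ) {f : ℤ → ℝ} (hf : ∀ n, 0 ≤ f n) :
    ∑ m ∈ R, (∑ n ∈ S, w (m - n) * f n) ^ p ≤ (∑' j, w j) ^ p * ∑ n ∈ S, f n ^ p := by
  set M := ∑' j, w j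
  have hM : 0 ≤ M := tsum_nonneg hw
  have hrow : ∀ m, ∑ n ∈ S, w (m - n) ≤ M := by
    intro m
    have := hs.sum_le_tsum (S.map (Equiv.subLeft m).toEmbedding) fun j _ => hw j
    simpa using this
  have hcol : ∀ n, ∑ m ∈ R, w (m - n) ≤ M := by
    intro n
    have := hs.sum_le_tsum (R.map (Equiv.subRight n).toEmbedding) fun j _ => hw j
    simpa using this
  calc ∑ m ∈ R, (∑ n ∈ S, w (m - n) * f n) ^ p
      ≤ ∑ m ∈ R, M ^ (p - 1) * ∑ n ∈ S, w (m - n) * f n ^ p := by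
        refine Finset.sum_le_sum fun m _ => ?_
        refine (sum_mul_rpow_le S hp (fun n => w (m - n)) f (fun _ => hw _) hf).trans ?_
        have h1 : 0 ≤ ∑ n ∈ S, w (m - n) * f n ^ p :=
          Finset.sum_nonneg fun i _ => mul_nonneg (hw _) (Real.rpow_nonneg (hf i) _)
        exact mul_le_mul_of_nonneg_right (Real.rpow_le_rpow
          (Finset.sum_nonneg fun i _ => hw _) (hrow m) (by linarith)) h1
    _ = M ^ (p - 1) * ∑ n ∈ S, (∑ m ∈ R, w (m - n)) * f n ^ p := by
        rw [← Finset.mul_sum, Finset.sum_comm]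
        simp only [Finset.sum_mul]
    _ ≤ M ^ (p - 1) * ∑ n ∈ S, M * f n ^ p := by
        gcongr with n hn
        · exact Real.rpow_nonneg (hf n) _
        · exact hcol n
    _ = _ := by
        rw [← Finset.mul_sum, ← mul_assoc]
        congr 1
        rcases hM.eq_or_lt with h | h
        · rw [← h, mul_zero, Real.zero_rpow (by linarith)]
        · rw [← Real.rpow_add_one h.ne', sub_add_cancel]

theorem convBounded_of_le_summable {p : ℝ} (hp : 1 ≤ p) {k w : ℤ → ℝ}
    (hkw : ∀ j, |k j| ≤ w j) (hs : Summable w) : ConvBounded p k := by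
  have hw : ∀ j, 0 ≤ w j := fun j => (abs_nonneg _).trans (hkw j)
  refine ⟨(∑' j, w j) ^ p, Real.rpow_nonneg (tsum_nonneg hw) _, fun S a => ?_⟩
  refine le_trans ?_ (sum_conv_rpow_le hp hw hs S S fun n => abs_nonneg (a n))
  refine Finset.sum_le_sum fun m _ => Real.rpow_le_rpow (abs_nonneg _) ?_ (by linarith)
  refine (Finset.abs_sum_le_sum_abs _ _).trans (Finset.sum_le_sum fun n _ => ?_)
  rw [abs_mul]
  exact mul_le_mul_of_nonneg_right (hkw _) (abs_nonneg _)

theorem summable_one_div_one_add_sq : Summable fun j : ℤ => 1 / (1 + (j : ℝ) ^ 2) := by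
  have h : Summable fun j : ℤ => 1 / (j : ℝ) ^ 2 + if j = 0 then (1 : ℝ) else 0 :=
    (Real.summable_one_div_int_pow.2 one_lt_two).add (summable_of_hasFiniteSupport
      ((Set.finite_singleton (0 : ℤ)).subset fun j hj => by
        by_contra h
        simp_all))
  refine h.of_nonneg_of_le (fun j => by positivity) fun j => ?_
  rcases eq_or_ne j 0 with rfl | hj
  · simp
  · have : (0 : ℝ) < (j : ℝ) ^ 2 := by positivity
    simp only [hj, if_false, add_zero]
    exact one_div_le_one_div_of_le this (by linarith)

/-- Duality: a bound on `ℓ^q` for an odd kernel gives one on `ℓ^p`, for conjugate exponents. -/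
theorem ConvBounded.dual {p q : ℝ} (hpq : p.HolderConjugate q) {k : ℤ → ℝ}
    (hodd : ∀ j, k (-j) = -k j) (hk : ConvBounded q k) : ConvBounded p k := by
  obtain ⟨C, hC, hk⟩ := hk
  have hp := hpq.pos
  have hq := hpq.symm.pos
  refine ⟨C ^ (p / q), by positivity, fun S a => ?_⟩
  set g : ℤ → ℝ := fun m => ∑ n ∈ S, k (m - n) * a n with hg
  -- the extremal sequence in Hölder's inequality for `g`
  set b : ℤ → ℝ := fun m => SignType.sign (g m) * |g m| ^ (p - 1) with hb
  set X := ∑ m ∈ S, |g m| ^ p with hX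
  set Y := ∑ n ∈ S, |a n| ^ p with hY
  have hX0 : 0 ≤ X := Finset.sum_nonneg fun _ _ => by positivity
  have hY0 : 0 ≤ Y := Finset.sum_nonneg fun _ _ => by positivity
  change X ≤ C ^ (p / q) * Y
  rcases hX0.eq_or_lt with h0 | hXpos
  · rw [← h0]; positivity
  have hgb : ∀ m, g m * b m = |g m| ^ p := by
    intro m
    rw [hb]
    dsimp only
    rw [← mul_assoc, mul_comm (g m), sign_mul_self]
    rcases (abs_nonneg (g m)).eq_or_lt with h | h
    · rw [← h, zero_mul, Real.zero_rpow hp.ne']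
    · nth_rewrite 1 [← Real.rpow_one |g m|]
      rw [← Real.rpow_add h]
      congr 1
      ring
  have hbq : ∀ m, |b m| ^ q ≤ |g m| ^ p := by
    intro m
    have h1 : |b m| ≤ |g m| ^ (p - 1) := by
      rw [hb]
      dsimp only
      rw [abs_mul, abs_of_nonneg (Real.rpow_nonneg (abs_nonneg (g m)) _)]
      refine mul_le_of_le_one_left (by positivity) ?_
      rcases lt_trichotomy (g m) 0 with h | h | h <;> simp [h]
    refine (Real.rpow_le_rpow (abs_nonneg _) h1 hq.le).trans (le_of_eq ?_)
    rw [← Real.rpow_mul (abs_nonneg _), hpq.sub_one_mul_conj]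
  have hdual : X = ∑ n ∈ S, (-a n) * ∑ m ∈ S, k (n - m) * b m := by
    calc X = ∑ m ∈ S, ∑ n ∈ S, k (m - n) * a n * b m := by
          rw [hX]
          refine Finset.sum_congr rfl fun m _ => ?_
          rw [← hgb, hg, Finset.sum_mul]
      _ = ∑ n ∈ S, ∑ m ∈ S, k (m - n) * a n * b m := Finset.sum_comm
      _ = _ := by
          refine Finset.sum_congr rfl fun n _ => ?_
          rw [Finset.mul_sum]
          refine Finset.sum_congr rfl fun m _ => ?_
          rw [← neg_sub m n, hodd]
          ring
  have hmain : X ≤ Y ^ (1 / p) * (C * X) ^ (1 / q) := by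
    rw [hdual]
    refine (Real.inner_le_Lp_mul_Lq S _ _ hpq).trans ?_
    simp only [abs_neg]
    gcongr
    refine (hk S b).trans ?_
    rw [← hdual]
    gcongr
    exact Finset.sum_le_sum fun m _ => hbq m
  -- divide by `X ^ (1 / q)` and raise to the power `p`
  have h1 : X ^ (1 / p) ≤ Y ^ (1 / p) * C ^ (1 / q) := by
    rw [Real.mul_rpow hC hX0, ← mul_assoc] at hmain
    have hXq : 0 < X ^ (1 / q) := Real.rpow_pos_of_pos hXpos _
    refine le_of_mul_le_mul_right (le_trans (le_of_eq ?_) hmain) hXq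
    rw [← Real.rpow_add hXpos, one_div, one_div, hpq.inv_add_inv_eq_one, Real.rpow_one]
  have h2 := Real.rpow_le_rpow (by positivity) h1 hp.le
  rw [Real.mul_rpow (by positivity) (by positivity), ← Real.rpow_mul hX0, ← Real.rpow_mul hY0,
    ← Real.rpow_mul hC, one_div_mul_cancel hp.ne', Real.rpow_one, Real.rpow_one] at h2
  calc X ≤ _ := h2
    _ = _ := by rw [mul_comm]; congr 2; ring

/-! ### A pointwise inequality in the right half-plane -/

/-- A quantitative form of the convergence `cos (p θ) → cos (p π / 2)` as `θ → ± π / 2`. The limit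
is negative for `1 < p ≤ 2`. -/
theorem neg_cos_mul_ge {p θ : ℝ} (hp : 0 ≤ p) (hp2 : p ≤ 2) (hθ : |θ| ≤ Real.pi / 2) :
    -Real.cos (p * (Real.pi / 2)) - Real.pi * Real.cos θ ≤ -Real.cos (θ * p) := by
  have hpi := Real.pi_pos
  have h1 := Real.mul_le_sin (x := Real.pi / 2 - |θ|) (by linarith) (by
    have := abs_nonneg θ
    linarith)
  rw [Real.sin_pi_div_two_sub, Real.cos_abs] at h1
  have h2 : Real.pi / 2 - |θ| ≤ Real.pi / 2 * Real.cos θ := by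
    have := mul_le_mul_of_nonneg_left h1 (by positivity : (0 : ℝ) ≤ Real.pi / 2)
    calc Real.pi / 2 - |θ| = Real.pi / 2 * (2 / Real.pi * (Real.pi / 2 - |θ|)) := by field_simp
      _ ≤ _ := this
  have h3 := (abs_le.1 (Real.abs_cos_sub_cos_le (|θ| * p) (p * (Real.pi / 2)))).2
  have h4 : Real.cos (|θ| * p) = Real.cos (θ * p) := by
    rw [← Real.cos_abs (θ * p), abs_mul, abs_of_nonneg hp]
  have h5 : |(|θ| * p) - p * (Real.pi / 2)| = p * (Real.pi / 2 - |θ|) := by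
    rw [abs_of_nonpos (by nlinarith)]
    ring
  rw [h4, h5] at h3
  have hc : 0 ≤ Real.pi / 2 * Real.cos θ := by linarith
  nlinarith

/-- The inequality behind M. Riesz's theorem: in the right half-plane `|Im z| ^ p` is at most
a multiple of `(Re z) ^ p` minus a multiple of the real part of the analytic function `z ^ p`. -/
theorem exists_abs_im_rpow_le {p : ℝ} (hp1 : 1 < p) (hp2 : p ≤ 2) :
    ∃ A B : ℝ, 0 ≤ A ∧ 0 ≤ B ∧ ∀ z : ℂ, 0 < z.re →
      |z.im| ^ p ≤ A * z.re ^ p - B * (z ^ (p : ℂ)).re := by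
  have hpi := Real.pi_pos
  set c := -Real.cos (p * (Real.pi / 2)) with hc
  have hc0 : 0 < c := by
    have := Real.cos_neg_of_pi_div_two_lt_of_lt (x := p * (Real.pi / 2)) (by nlinarith)
      (by nlinarith)
    linarith
  set D := 2 / c * Real.pi with hD
  have hD0 : 0 < D := by positivity
  refine ⟨D ^ p, 2 / c, by positivity, by positivity, fun z hz => ?_⟩
  set θ := Complex.arg z with hθ
  set r := ‖z‖ with hr
  have hr0 : 0 ≤ r := norm_nonneg z
  have hθ2 : |θ| ≤ Real.pi / 2 := Complex.abs_arg_le_pi_div_two_iff.2 hz.le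
  have hcos : 0 ≤ Real.cos θ := Real.cos_nonneg_of_mem_Icc (abs_le.1 hθ2)
  have hre : z.re = r * Real.cos θ := (Complex.norm_mul_cos_arg z).symm
  have him : |z.im| ≤ r := Complex.abs_im_le_norm z
  have hkey : 1 ≤ D ^ p * Real.cos θ ^ p - 2 / c * Real.cos (θ * p) := by
    have h1 := neg_cos_mul_ge (by linarith) hp2 hθ2
    have h2 : 2 - D * Real.cos θ ≤ 2 / c * (-Real.cos (θ * p)) := by
      have := mul_le_mul_of_nonneg_left h1 (by positivity : 0 ≤ 2 / c)
      calc 2 - D * Real.cos θ = 2 / c * (c - Real.pi * Real.cos θ) := by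
            rw [hD]; field_simp
        _ ≤ _ := this
    rw [← Real.mul_rpow hD0.le hcos]
    have hx : 0 ≤ D * Real.cos θ := by positivity
    have h3 : D * Real.cos θ - 1 ≤ (D * Real.cos θ) ^ p := by
      rcases le_total (D * Real.cos θ) 1 with h | h
      · have := Real.rpow_nonneg hx p
        linarith
      · have := Real.rpow_le_rpow_of_exponent_le h hp1.le
        rw [Real.rpow_one] at this
        linarith
    linarith
  rw [Complex.cpow_ofReal_re, hre, Real.mul_rpow hr0 hcos]
  calc |z.im| ^ p ≤ r ^ p := Real.rpow_le_rpow (abs_nonneg _) him (by linarith)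
    _ = r ^ p * 1 := (mul_one _).symm
    _ ≤ r ^ p * (D ^ p * Real.cos θ ^ p - 2 / c * Real.cos (θ * p)) := by gcongr
    _ = _ := by ring

/-! ### The analytic extension of a finite sequence -/

/-- The function `i ∑_{n ∈ S} a_n / (z - n)`. On the line `Im z = 1` its real and imaginary parts
are the convolutions of `a` with `1 / (x ^ 2 + 1)` and `x / (x ^ 2 + 1)`. -/
noncomputable def cauchySum (S : Finset ℤ) (a : ℤ → ℝ) (z : ℂ) : ℂ :=
  ∑ n ∈ S, (a n : ℂ) * (Complex.I / (z - n))

theorem cauchySum_re (S : Finset ℤ) (a : ℤ → ℝ) (x y : ℝ) :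
    (cauchySum S a (x + y * Complex.I)).re = ∑ n ∈ S, a n * (y / ((x - n) ^ 2 + y ^ 2)) := by
  rw [cauchySum, Complex.re_sum]
  refine Finset.sum_congr rfl fun n _ => ?_
  simp [Complex.div_re, Complex.normSq_apply, pow_two]

theorem cauchySum_im (S : Finset ℤ) (a : ℤ → ℝ) (x y : ℝ) :
    (cauchySum S a (x + y * Complex.I)).im =
      ∑ n ∈ S, a n * ((x - n) / ((x - n) ^ 2 + y ^ 2)) := by
  rw [cauchySum, Complex.im_sum]
  refine Finset.sum_congr rfl fun n _ => ?_
  simp [Complex.div_im, Complex.normSq_apply, pow_two]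

theorem cauchySum_re_pos {S : Finset ℤ} {a : ℤ → ℝ} (ha : ∀ n, 0 ≤ a n)
    (hpos : ∃ n ∈ S, 0 < a n) {z : ℂ} (hz : 0 < z.im) : 0 < (cauchySum S a z).re := by
  rw [← Complex.re_add_im z, cauchySum_re]
  refine Finset.sum_pos' (fun n _ => mul_nonneg (ha n) (by positivity)) ?_
  obtain ⟨n, hn, h⟩ := hpos
  exact ⟨n, hn, by positivity⟩

theorem differentiableAt_cauchySum (S : Finset ℤ) (a : ℤ → ℝ) {z : ℂ} (hz : 0 < z.im) :
    DifferentiableAt ℂ (cauchySum S a) z := by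
  unfold cauchySum
  refine DifferentiableAt.fun_sum fun n _ => ?_
  have : z - n ≠ 0 := by
    intro h
    have := congrArg Complex.im h
    simp at this
    linarith
  fun_prop (disch := assumption)

theorem differentiableAt_cauchySum_cpow {S : Finset ℤ} {a : ℤ → ℝ} (ha : ∀ n, 0 ≤ a n)
    (hpos : ∃ n ∈ S, 0 < a n) (p : ℂ) {z : ℂ} (hz : 0 < z.im) :
    DifferentiableAt ℂ (fun z => cauchySum S a z ^ p) z :=
  (differentiableAt_cauchySum S a hz).cpow_const (Or.inl (cauchySum_re_pos ha hpos hz))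

theorem norm_cauchySum_le (S : Finset ℤ) {a : ℤ → ℝ} (ha : ∀ n, 0 ≤ a n) {z : ℂ} {d : ℝ}
    (hd : 0 < d) (hz : ∀ n ∈ S, d ≤ ‖z - n‖) : ‖cauchySum S a z‖ ≤ (∑ n ∈ S, a n) / d := by
  rw [cauchySum, Finset.sum_div]
  refine norm_sum_le_of_le S fun n hn => ?_
  rw [norm_mul, norm_div, Complex.norm_I, Complex.norm_real, Real.norm_of_nonneg (ha n), mul_one_div]
  exact div_le_div_of_nonneg_left (ha n) hd (hz n hn)

theorem intervalIntegrable_cauchySum_cpow {S : Finset ℤ} {a : ℤ → ℝ} (ha : ∀ n, 0 ≤ a n)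
    (hpos : ∃ n ∈ S, 0 < a n) (p : ℂ) (u v : ℝ) :
    IntervalIntegrable (fun x : ℝ => cauchySum S a (x + Complex.I) ^ p) MeasureTheory.volume u v := by
  refine Continuous.intervalIntegrable ?_ u v
  refine continuous_iff_continuousAt.2 fun x => ?_
  have h := (differentiableAt_cauchySum_cpow ha hpos p (z := x + Complex.I) (by simp)).continuousAt
  exact ContinuousAt.comp (f := fun x : ℝ => (x : ℂ) + Complex.I) h (by fun_prop)

/-- By Cauchy's theorem on the rectangle `[-R, R] × [1, R + 1]`, the integral of the `p`-th power
along its lower side is `O(R^(1 - p))`. -/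
theorem norm_integral_cauchySum_cpow_le {S : Finset ℤ} {a : ℤ → ℝ} (ha : ∀ n, 0 ≤ a n)
    (hpos : ∃ n ∈ S, 0 < a n) {p : ℝ} (hp : 0 ≤ p) {R : ℝ} (hR : 0 < R)
    (hS : ∀ n ∈ S, |(n : ℝ)| ≤ R / 2) :
    ‖∫ x in -R..R, cauchySum S a (x + Complex.I) ^ (p : ℂ)‖ ≤
      4 * R * ((∑ n ∈ S, a n) / (R / 2)) ^ p := by
  set F : ℂ → ℂ := fun z => cauchySum S a z ^ (p : ℂ) with hF
  set E := ((∑ n ∈ S, a n) / (R / 2)) ^ p with hE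
  have hbd : ∀ z : ℂ, (∀ n ∈ S, R / 2 ≤ ‖z - n‖) → ‖F z‖ ≤ E := by
    intro z hz
    rw [hF]
    dsimp only
    rw [Complex.norm_cpow_real]
    exact Real.rpow_le_rpow (norm_nonneg _) (norm_cauchySum_le S ha (by positivity) hz) hp
  have hrect := Complex.integral_boundary_rect_eq_zero_of_differentiableOn F
    ((-R : ℝ) + (1 : ℝ) * Complex.I) ((R : ℝ) + (R + 1 : ℝ) * Complex.I) (by
      intro z hz
      have h2 := hz.2
      simp at h2
      rw [Set.uIcc_of_le (by linarith)] at h2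
      exact (differentiableAt_cauchySum_cpow ha hpos p (by linarith [h2.1])).differentiableWithinAt)
  simp only [Complex.add_re, Complex.add_im, Complex.ofReal_re, Complex.ofReal_im, Complex.mul_re,
    Complex.mul_im, Complex.I_re, Complex.I_im, mul_zero, mul_one, zero_add, add_zero, sub_zero]
    at hrect
  have htop : ‖∫ x in -R..R, F (x + (R + 1 : ℝ) * Complex.I)‖ ≤ E * |R - -R| := by
    refine intervalIntegral.norm_integral_le_of_norm_le_const fun x _ => hbd _ fun n _ => ?_
    refine le_trans ?_ (Complex.abs_im_le_norm _)
    simp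
    rw [abs_of_pos (by linarith)]
    linarith
  have hside : ∀ s : ℝ, |s| = R → ‖∫ y in (1 : ℝ)..R + 1, F (s + y * Complex.I)‖ ≤
      E * |R + 1 - 1| := by
    intro s hs
    refine intervalIntegral.norm_integral_le_of_norm_le_const fun x _ => hbd _ fun n hn => ?_
    refine le_trans ?_ (Complex.abs_re_le_norm _)
    simp
    have := abs_sub_abs_le_abs_sub s n
    have := hS n hn
    linarith
  have hr := hside R (abs_of_pos hR)
  have hl := hside (-R) (by rw [abs_neg, abs_of_pos hR])
  have habs1 : |R - -R| = 2 * R := by rw [abs_of_pos (by linarith)]; ring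
  have habs2 : |R + 1 - 1| = R := by rw [add_sub_cancel_right, abs_of_pos hR]
  rw [habs1] at htop
  rw [habs2] at hr hl
  have heq : ∫ x in -R..R, cauchySum S a (x + Complex.I) ^ (p : ℂ) =
      (∫ x in -R..R, F (x + (R + 1 : ℝ) * Complex.I))
      - Complex.I • (∫ y in (1 : ℝ)..R + 1, F (R + y * Complex.I))
      + Complex.I • ∫ y in (1 : ℝ)..R + 1, F ((-R : ℝ) + y * Complex.I) := by
    have : ∀ x : ℝ, F (x + (1 : ℝ) * Complex.I) = cauchySum S a (x + Complex.I) ^ (p : ℂ) := by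
      intro x; simp [hF]
    simp only [this] at hrect
    linear_combination hrect
  rw [heq]
  refine (norm_add_le _ _).trans ?_
  have h3 := norm_sub_le (∫ x in -R..R, F (x + (R + 1 : ℝ) * Complex.I))
    (Complex.I • (∫ y in (1 : ℝ)..R + 1, F (R + y * Complex.I)))
  rw [norm_smul, Complex.norm_I, one_mul] at h3 ⊢
  linarith

/-! ### The discrete Hilbert kernel is bounded on finite sections -/

theorem one_div_sq_add_one_le {j s : ℝ} (hs0 : 0 ≤ s) (hs1 : s ≤ 1) :
    1 / ((j + s) ^ 2 + 1) ≤ 3 * (1 / (1 + j ^ 2)) := by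
  rw [mul_one_div, div_le_div_iff₀ (by positivity) (by positivity)]
  nlinarith [sq_nonneg (j + 2 * s)]

/-- The kernels `1 / j` and `y / (y ^ 2 + 1)`, `j ≤ y ≤ j + 1`, differ by a summable kernel. For
`j = 0` the value `1 / 0 = 0` is the one that the discrete Hilbert transform needs. -/
theorem abs_one_div_sub_le (j : ℤ) {s : ℝ} (hs0 : 0 ≤ s) (hs1 : s ≤ 1) :
    |1 / (j : ℝ) - (j + s) / ((j + s) ^ 2 + 1)| ≤ 4 * (1 / (1 + (j : ℝ) ^ 2)) := by
  rcases eq_or_ne j 0 with rfl | hj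
  · have h : (0 : ℝ) < s ^ 2 + 1 := by positivity
    simp only [Int.cast_zero, div_zero, zero_add, zero_sub, abs_neg]
    rw [abs_of_nonneg (by positivity), div_le_iff₀ h]
    nlinarith
  · have hj1 : (1 : ℝ) ≤ |(j : ℝ)| := by exact_mod_cast Int.one_le_abs hj
    have hj0 : (j : ℝ) ≠ 0 := by exact_mod_cast hj
    set y := (j : ℝ) + s with hy
    have hyp : 0 < y ^ 2 + 1 := by positivity
    have e : 1 / (j : ℝ) - y / (y ^ 2 + 1) = (y * s + 1) / (j * (y ^ 2 + 1)) := by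
      field_simp
      rw [hy]
      ring
    rw [e, abs_div, abs_mul, abs_of_pos hyp, mul_one_div,
      div_le_div_iff₀ (by positivity) (by positivity)]
    have hnum : |y * s + 1| ≤ |y| + 1 := by
      refine (abs_add_le _ _).trans ?_
      rw [abs_mul, abs_of_nonneg hs0, abs_one]
      nlinarith [abs_nonneg y]
    have hjy : |(j : ℝ)| ≤ |y| + 1 := by
      have : (j : ℝ) = y - s := by rw [hy]; ring
      rw [this]
      refine (abs_sub _ _).trans ?_
      rw [abs_of_nonneg hs0]
      linarith
    have hsq : 1 + (j : ℝ) ^ 2 ≤ 2 * |(j : ℝ)| * |(j : ℝ)| := by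
      rw [← sq_abs]
      nlinarith
    calc |y * s + 1| * (1 + (j : ℝ) ^ 2)
        ≤ (|y| + 1) * (2 * |(j : ℝ)| * |(j : ℝ)|) := by gcongr
      _ = 2 * ((|y| + 1) * |(j : ℝ)|) * |(j : ℝ)| := by ring
      _ ≤ 2 * ((|y| + 1) * (|y| + 1)) * |(j : ℝ)| := by gcongr
      _ ≤ 4 * (y ^ 2 + 1) * |(j : ℝ)| := by
          refine mul_le_mul_of_nonneg_right ?_ (abs_nonneg _)
          rw [← sq_abs y]
          nlinarith [sq_nonneg (|y| - 1)]
      _ = _ := by ring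

/-- Near the integer `m`, the discrete Hilbert transform of `a ≥ 0` is controlled by a convolution
with a summable kernel and by the real part of `cauchySum S a ^ p` on the line `Im z = 1`. -/
theorem exists_abs_hilbert_rpow_le {p : ℝ} (hp1 : 1 < p) (hp2 : p ≤ 2) :
    ∃ E B : ℝ, 0 ≤ E ∧ 0 ≤ B ∧ ∀ (S : Finset ℤ) (a : ℤ → ℝ), (∀ n, 0 ≤ a n) →
      (∃ n ∈ S, 0 < a n) → ∀ (m : ℤ) (x : ℝ), (m : ℝ) ≤ x → x ≤ m + 1 →
      |∑ n ∈ S, 1 / ((m - n : ℤ) : ℝ) * a n| ^ p ≤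
        E * (∑ n ∈ S, 1 / (1 + ((m - n : ℤ) : ℝ) ^ 2) * a n) ^ p
          - B * (cauchySum S a (x + Complex.I) ^ (p : ℂ)).re := by
  obtain ⟨A, B, hA, hB, hAB⟩ := exists_abs_im_rpow_le hp1 hp2
  refine ⟨2 ^ p * (A * 3 ^ p + 4 ^ p), 2 ^ p * B, by positivity, by positivity, ?_⟩
  intro S a ha hpos m x hmx hxm
  have hp0 : 0 ≤ p := by linarith
  set g := ∑ n ∈ S, 1 / ((m - n : ℤ) : ℝ) * a n with hg
  set W := ∑ n ∈ S, 1 / (1 + ((m - n : ℤ) : ℝ) ^ 2) * a n with hW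
  set z := cauchySum S a (x + Complex.I) with hz
  have hW0 : 0 ≤ W := Finset.sum_nonneg fun n _ => mul_nonneg (by positivity) (ha n)
  have hz0 : 0 < z.re := cauchySum_re_pos ha hpos (by simp)
  have hx1 : (x : ℂ) + Complex.I = x + (1 : ℝ) * Complex.I := by simp
  have hxn : ∀ n : ℤ, x - n = ((m - n : ℤ) : ℝ) + (x - m) := by
    intro n; push_cast; ring
  have hre : z.re ≤ 3 * W := by
    rw [hz, hx1, cauchySum_re, hW, Finset.mul_sum]
    refine Finset.sum_le_sum fun n _ => ?_
    rw [hxn, one_pow, mul_comm, ← mul_assoc]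
    exact mul_le_mul_of_nonneg_right
      (one_div_sq_add_one_le (by linarith) (by linarith)) (ha n)
  have him : |g - z.im| ≤ 4 * W := by
    rw [hz, hx1, cauchySum_im, hW, Finset.mul_sum, hg, ← Finset.sum_sub_distrib]
    refine (Finset.abs_sum_le_sum_abs _ _).trans (Finset.sum_le_sum fun n _ => ?_)
    rw [hxn, one_pow, mul_comm (a n), ← sub_mul, abs_mul, abs_of_nonneg (ha n), ← mul_assoc]
    exact mul_le_mul_of_nonneg_right
      (abs_one_div_sub_le _ (by linarith) (by linarith)) (ha n)
  have hg' : |g| ≤ |z.im| + 4 * W := by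
    have := abs_sub_abs_le_abs_sub g z.im
    linarith
  calc |g| ^ p ≤ (|z.im| + 4 * W) ^ p := Real.rpow_le_rpow (abs_nonneg _) hg' hp0
    _ ≤ 2 ^ p * (|z.im| ^ p + (4 * W) ^ p) :=
        add_rpow_le_two_rpow_mul hp0 (abs_nonneg _) (by positivity)
    _ ≤ 2 ^ p * ((A * (3 * W) ^ p - B * (z ^ (p : ℂ)).re) + (4 * W) ^ p) := by
        have h1 := hAB z hz0
        have h2 := Real.rpow_le_rpow hz0.le hre hp0
        have h3 := mul_le_mul_of_nonneg_left h2 hA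
        gcongr
        linarith
    _ = _ := by
        rw [Real.mul_rpow (by norm_num) hW0, Real.mul_rpow (by norm_num) hW0]
        ring

theorem sum_abs_hilbert_rpow_le_of_nonneg {p : ℝ} (hp1 : 1 < p) (hp2 : p ≤ 2) :
    ∃ C : ℝ, 0 ≤ C ∧ ∀ (S : Finset ℤ) (a : ℤ → ℝ), (∀ n, 0 ≤ a n) →
      ∑ m ∈ S, |∑ n ∈ S, 1 / ((m - n : ℤ) : ℝ) * a n| ^ p ≤ C * ∑ n ∈ S, a n ^ p := by
  obtain ⟨E, B, hE, hB, hEB⟩ := exists_abs_hilbert_rpow_le hp1 hp2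
  set M := ∑' j : ℤ, 1 / (1 + (j : ℝ) ^ 2) with hM
  have hM0 : 0 ≤ M := tsum_nonneg fun j => by positivity
  refine ⟨E * M ^ p, by positivity, fun S a ha => ?_⟩
  by_cases hpos : ∃ n ∈ S, 0 < a n
  swap
  · have h0 : ∀ n ∈ S, a n = 0 := fun n hn =>
      le_antisymm (not_lt.1 fun h => hpos ⟨n, hn, h⟩) (ha n)
    have h1 : ∀ m : ℤ, ∑ n ∈ S, 1 / ((m - n : ℤ) : ℝ) * a n = 0 := fun m =>
      Finset.sum_eq_zero fun n hn => by rw [h0 n hn, mul_zero]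
    have hp0 : p ≠ 0 := by linarith
    simp only [h1, abs_zero, Real.zero_rpow hp0, Finset.sum_const_zero]
    exact mul_nonneg (by positivity) (Finset.sum_nonneg fun n _ => Real.rpow_nonneg (ha n) _)
  set g : ℤ → ℝ := fun m => ∑ n ∈ S, 1 / ((m - n : ℤ) : ℝ) * a n with hg
  set W : ℤ → ℝ := fun m => ∑ n ∈ S, 1 / (1 + ((m - n : ℤ) : ℝ) ^ 2) * a n with hW
  set F : ℝ → ℂ := fun x => cauchySum S a (x + Complex.I) ^ (p : ℂ) with hF
  have hFint : ∀ u v, IntervalIntegrable F MeasureTheory.volume u v :=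
    intervalIntegrable_cauchySum_cpow ha hpos p
  have hcell : ∀ m : ℤ, |g m| ^ p ≤ E * W m ^ p - B * (∫ x in (m : ℝ)..m + 1, F x).re := by
    intro m
    have hreint : IntervalIntegrable (fun x => (F x).re) MeasureTheory.volume (m : ℝ) (m + 1) :=
      ⟨(hFint m (m + 1)).1.re, (hFint m (m + 1)).2.re⟩
    have h1 := intervalIntegral.integral_mono_on (a := (m : ℝ)) (b := m + 1)
      (f := fun _ => |g m| ^ p) (g := fun x => E * W m ^ p - B * (F x).re)
      (μ := MeasureTheory.volume) (by linarith) (by simp)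
      ((intervalIntegrable_const).sub
        (hreint.const_mul B))
      fun x hx => hEB S a ha hpos m x hx.1 hx.2
    rw [intervalIntegral.integral_sub intervalIntegrable_const
        (hreint.const_mul B),
      intervalIntegral.integral_const_mul B] at h1
    simp only [intervalIntegral.integral_const, add_sub_cancel_left, one_smul] at h1
    have h2 : ∫ x in (m : ℝ)..m + 1, (F x).re = (∫ x in (m : ℝ)..m + 1, F x).re :=
      Complex.reCLM.intervalIntegral_comp_comm (hFint _ _)
    rwa [h2] at h1
  set Z := ∑ n ∈ S, a n with hZ
  have hZ0 : 0 ≤ Z := Finset.sum_nonneg fun n _ => ha n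
  obtain ⟨N₀, hN₀⟩ : ∃ N₀ : ℕ, ∀ n ∈ S, |(n : ℝ)| ≤ N₀ / 2 ∧ n ∈ Finset.Ico (-(N₀ : ℤ)) N₀ := by
    refine ⟨2 * (∑ n ∈ S, n.natAbs) + 1, fun n hn => ?_⟩
    have h1 : n.natAbs ≤ ∑ n ∈ S, n.natAbs :=
      Finset.single_le_sum (f := fun n : ℤ => n.natAbs) (fun _ _ => Nat.zero_le _) hn
    constructor
    · have h2 : |(n : ℝ)| = (n.natAbs : ℝ) := by rw [Nat.cast_natAbs, Int.cast_abs]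
      have h3 : (n.natAbs : ℝ) ≤ ((∑ n ∈ S, n.natAbs : ℕ) : ℝ) := by exact_mod_cast h1
      rw [h2]
      push_cast at h3 ⊢
      linarith
    · rw [Finset.mem_Ico]
      omega
  have hbound : ∀ N : ℕ, N₀ ≤ N → 0 < N → ∑ m ∈ S, |g m| ^ p ≤
      E * M ^ p * ∑ n ∈ S, a n ^ p + B * (4 * N * (Z / (N / 2)) ^ p) := by
    intro N hN hN1
    have hN' : (N₀ : ℝ) ≤ N := by exact_mod_cast hN
    set R : Finset ℤ := Finset.Ico (-(N : ℤ)) N with hR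
    have hSR : S ⊆ R := by
      intro n hn
      have := (hN₀ n hn).2
      rw [Finset.mem_Ico] at this
      rw [hR, Finset.mem_Ico]
      omega
    have hadj : ∑ m ∈ R, ∫ x in (m : ℝ)..m + 1, F x = ∫ x in (-N : ℝ)..N, F x := by
      have h := intervalIntegral.sum_integral_adjacent_intervals (f := F)
        (μ := MeasureTheory.volume) (a := fun k : ℕ => -(N : ℝ) + k) (n := 2 * N)
        fun k _ => hFint _ _
      have e1 : -(N : ℝ) + ((0 : ℕ) : ℝ) = -N := by simp
      have e2 : -(N : ℝ) + ((2 * N : ℕ) : ℝ) = N := by push_cast; ring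
      rw [e1, e2] at h
      rw [← h]
      symm
      refine Finset.sum_bij (fun k _ => -(N : ℤ) + k) ?_ ?_ ?_ ?_
      · intro k hk
        rw [Finset.mem_range] at hk
        rw [hR, Finset.mem_Ico]
        omega
      · intro k _ l _ hkl
        omega
      · intro m hm
        rw [hR, Finset.mem_Ico] at hm
        exact ⟨(m + N).toNat, by rw [Finset.mem_range]; omega, by omega⟩
      · intro k _
        push_cast
        rw [add_assoc]
    have hint := norm_integral_cauchySum_cpow_le (p := p) (R := N) ha hpos (by linarith)
      (by exact_mod_cast hN1) fun n hn => (hN₀ n hn).1.trans (by linarith)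
    have hre : -(∫ x in (-N : ℝ)..N, F x).re ≤ 4 * N * (Z / (N / 2)) ^ p := by
      have := (abs_le.1 (Complex.abs_re_le_norm (∫ x in (-N : ℝ)..N, F x))).1
      linarith
    calc ∑ m ∈ S, |g m| ^ p ≤ ∑ m ∈ R, |g m| ^ p :=
          Finset.sum_le_sum_of_subset_of_nonneg hSR fun _ _ _ => by positivity
      _ ≤ ∑ m ∈ R, (E * W m ^ p - B * (∫ x in (m : ℝ)..m + 1, F x).re) :=
          Finset.sum_le_sum fun m _ => hcell m
      _ = E * ∑ m ∈ R, W m ^ p + B * -(∫ x in (-N : ℝ)..N, F x).re := by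
          rw [Finset.sum_sub_distrib, ← Finset.mul_sum, ← Finset.mul_sum, ← Complex.re_sum, hadj]
          ring
      _ ≤ E * (M ^ p * ∑ n ∈ S, a n ^ p) + B * (4 * N * (Z / (N / 2)) ^ p) := by
          gcongr
          exact sum_conv_rpow_le hp1.le (w := fun j : ℤ => 1 / (1 + (j : ℝ) ^ 2))
            (fun j => by positivity) summable_one_div_one_add_sq R S ha
      _ = _ := by ring
  have hlim : Filter.Tendsto (fun N : ℕ => E * M ^ p * ∑ n ∈ S, a n ^ p +
      B * (4 * N * (Z / (N / 2)) ^ p)) Filter.atTop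
      (nhds (E * M ^ p * ∑ n ∈ S, a n ^ p + B * (4 * (2 * Z) ^ p * 0))) := by
    have h1 := (tendsto_rpow_neg_atTop (y := p - 1) (by linarith)).comp
      (tendsto_natCast_atTop_atTop (R := ℝ))
    refine Filter.Tendsto.congr' ?_
      (((h1.const_mul (4 * (2 * Z) ^ p)).const_mul B).const_add (E * M ^ p * ∑ n ∈ S, a n ^ p))
    filter_upwards [Filter.eventually_gt_atTop 0] with N hN
    have hN' : (0 : ℝ) < N := by exact_mod_cast hN
    have e : Z / (N / 2) = 2 * Z / N := by field_simp
    rw [e, Real.div_rpow (by positivity) hN'.le, Function.comp_apply, neg_sub, Real.rpow_sub hN',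
      Real.rpow_one]
    ring
  rw [mul_zero, mul_zero, add_zero] at hlim
  refine ge_of_tendsto hlim ?_
  filter_upwards [Filter.eventually_ge_atTop N₀, Filter.eventually_gt_atTop 0] with N h1 h2
  exact hbound N h1 h2

theorem convBounded_one_div_of_le_two {p : ℝ} (hp1 : 1 < p) (hp2 : p ≤ 2) :
    ConvBounded p fun j => 1 / (j : ℝ) := by
  obtain ⟨C, hC, h⟩ := sum_abs_hilbert_rpow_le_of_nonneg hp1 hp2
  have hp0 : 0 ≤ p := by linarith
  refine ⟨2 ^ p * (2 * C), by positivity, fun S a => ?_⟩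
  have hpart : ∀ b : ℤ → ℝ, (∀ n, 0 ≤ b n) → (∀ n, b n ≤ |a n|) →
      ∑ m ∈ S, |∑ n ∈ S, 1 / ((m - n : ℤ) : ℝ) * b n| ^ p ≤ C * ∑ n ∈ S, |a n| ^ p := by
    intro b hb hba
    refine (h S b hb).trans ?_
    gcongr with n _
    exacts [hb n, hba n]
  calc ∑ m ∈ S, |∑ n ∈ S, 1 / ((m - n : ℤ) : ℝ) * a n| ^ p
      ≤ ∑ m ∈ S, 2 ^ p * (|∑ n ∈ S, 1 / ((m - n : ℤ) : ℝ) * (a n)⁺| ^ p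
          + |∑ n ∈ S, 1 / ((m - n : ℤ) : ℝ) * (a n)⁻| ^ p) := by
        refine Finset.sum_le_sum fun m _ => ?_
        refine le_trans ?_ (add_rpow_le_two_rpow_mul hp0 (abs_nonneg _) (abs_nonneg _))
        refine Real.rpow_le_rpow (abs_nonneg _) (le_trans (le_of_eq ?_) (abs_sub _ _)) hp0
        rw [← Finset.sum_sub_distrib]
        congr 1
        refine Finset.sum_congr rfl fun n _ => ?_
        rw [← mul_sub, posPart_sub_negPart]
    _ = 2 ^ p * (∑ m ∈ S, |∑ n ∈ S, 1 / ((m - n : ℤ) : ℝ) * (a n)⁺| ^ p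
          + ∑ m ∈ S, |∑ n ∈ S, 1 / ((m - n : ℤ) : ℝ) * (a n)⁻| ^ p) := by
        rw [← Finset.mul_sum, Finset.sum_add_distrib]
    _ ≤ 2 ^ p * (C * ∑ n ∈ S, |a n| ^ p + C * ∑ n ∈ S, |a n| ^ p) := by
        gcongr
        · exact hpart _ (fun n => posPart_nonneg _) fun n => sup_le (le_abs_self _) (abs_nonneg _)
        · exact hpart _ (fun n => negPart_nonneg _) fun n => sup_le (neg_le_abs _) (abs_nonneg _)
    _ = _ := by ring

/-- The discrete M. Riesz theorem, on finite sections. -/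
theorem convBounded_one_div {p : ℝ} (hp : 1 < p) : ConvBounded p fun j => 1 / (j : ℝ) := by
  rcases le_total p 2 with h | h
  · exact convBounded_one_div_of_le_two hp h
  · have hpq := Real.HolderConjugate.conjExponent hp
    refine ConvBounded.dual hpq (fun j => by push_cast; rw [div_neg]) ?_
    refine convBounded_one_div_of_le_two hpq.symm.lt ?_
    rw [Real.conjExponent, div_le_iff₀ (by linarith)]
    linarith

theorem convBounded_one_div_add_half {p : ℝ} (hp : 1 < p) :
    ConvBounded p fun j => 1 / ((j : ℝ) + 1 / 2) := by
  have hdiff : ConvBounded p fun j => 1 / ((j : ℝ) + 1 / 2) - 1 / (j : ℝ) := by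
    refine convBounded_of_le_summable hp.le (fun j => ?_)
      (summable_one_div_one_add_sq.mul_left 2)
    rcases eq_or_ne j 0 with rfl | hj
    · norm_num
    · have hj1 : (1 : ℝ) ≤ |(j : ℝ)| := by exact_mod_cast Int.one_le_abs hj
      have hj0 : (j : ℝ) ≠ 0 := by exact_mod_cast hj
      have hhalf : |(j : ℝ)| / 2 ≤ |(j : ℝ) + 1 / 2| := by
        have := abs_sub_abs_le_abs_sub (j : ℝ) (-(1 / 2))
        rw [sub_neg_eq_add, abs_neg, abs_of_pos (by norm_num : (0 : ℝ) < 1 / 2)] at this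
        linarith
      have hne : (j : ℝ) + 1 / 2 ≠ 0 := by
        intro h
        rw [h, abs_zero] at hhalf
        linarith
      have e : 1 / ((j : ℝ) + 1 / 2) - 1 / (j : ℝ) = -(1 / 2) / (((j : ℝ) + 1 / 2) * j) := by
        rw [div_sub_div _ _ hne hj0]
        congr 1
        ring
      rw [e, abs_div, abs_mul, abs_neg, abs_of_pos (by norm_num : (0 : ℝ) < 1 / 2), mul_one_div,
        div_le_div_iff₀ (by positivity) (by positivity)]
      have hsq : 1 + (j : ℝ) ^ 2 ≤ 2 * (|(j : ℝ)| * |(j : ℝ)|) := by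
        rw [← sq_abs]
        nlinarith
      have := mul_le_mul_of_nonneg_right hhalf (abs_nonneg (j : ℝ))
      linarith
  simpa using hdiff.add (by linarith) (convBounded_one_div hp)

/-! ### Convolution operators on `ℓ^p` -/

theorem toReal_pos_of_fact {p : ℝ≥0∞} [Fact (1 ≤ p)] (hp : p ≠ ∞) : 0 < p.toReal :=
  ENNReal.toReal_pos (zero_lt_one.trans_le Fact.out).ne' hp

theorem sum_norm_conv_rpow_le {p C : ℝ} (hp : 0 ≤ p) (hC : 0 ≤ C) {k : ℤ → ℝ} {S : Finset ℤ}
    (hk : ∀ a : ℤ → ℝ, ∑ m ∈ S, |∑ n ∈ S, k (m - n) * a n| ^ p ≤ C * ∑ n ∈ S, |a n| ^ p)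
    (a : ℤ → ℂ) :
    ∑ m ∈ S, ‖∑ n ∈ S, (k (m - n) : ℂ) * a n‖ ^ p ≤ 2 ^ p * (2 * C) * ∑ n ∈ S, ‖a n‖ ^ p := by
  have hre : ∑ m ∈ S, |∑ n ∈ S, k (m - n) * (a n).re| ^ p ≤ C * ∑ n ∈ S, ‖a n‖ ^ p := by
    refine (hk _).trans ?_
    gcongr with n _
    exact Complex.abs_re_le_norm _
  have him : ∑ m ∈ S, |∑ n ∈ S, k (m - n) * (a n).im| ^ p ≤ C * ∑ n ∈ S, ‖a n‖ ^ p := by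
    refine (hk _).trans ?_
    gcongr with n _
    exact Complex.abs_im_le_norm _
  calc ∑ m ∈ S, ‖∑ n ∈ S, (k (m - n) : ℂ) * a n‖ ^ p
      ≤ ∑ m ∈ S, 2 ^ p * (|∑ n ∈ S, k (m - n) * (a n).re| ^ p
          + |∑ n ∈ S, k (m - n) * (a n).im| ^ p) := by
        refine Finset.sum_le_sum fun m _ => ?_
        refine le_trans ?_ (add_rpow_le_two_rpow_mul hp (abs_nonneg _) (abs_nonneg _))
        refine Real.rpow_le_rpow (norm_nonneg _)
          ((Complex.norm_le_abs_re_add_abs_im _).trans (le_of_eq ?_)) hp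
        simp only [Complex.re_sum, Complex.im_sum, Complex.re_ofReal_mul, Complex.im_ofReal_mul]
    _ = 2 ^ p * (∑ m ∈ S, |∑ n ∈ S, k (m - n) * (a n).re| ^ p
          + ∑ m ∈ S, |∑ n ∈ S, k (m - n) * (a n).im| ^ p) := by
        rw [← Finset.mul_sum, Finset.sum_add_distrib]
    _ ≤ 2 ^ p * (C * ∑ n ∈ S, ‖a n‖ ^ p + C * ∑ n ∈ S, ‖a n‖ ^ p) := by gcongr
    _ = _ := by ring

/-- Boundedness of the finite sections forces absolute convergence of each entry: test the `m`-th
row on the sequence `sign (k (m - n)) ‖a_n‖`. -/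
theorem ConvBounded.summable {p : ℝ≥0∞} [Fact (1 ≤ p)] (hp : p ≠ ∞) {k : ℤ → ℝ}
    (hk : ConvBounded p.toReal k) (a : EllP p) (m : ℤ) :
    Summable fun n => (k (m - n) : ℂ) * a n := by
  obtain ⟨C, hC, hk⟩ := hk
  have hq := toReal_pos_of_fact hp
  set q := p.toReal
  refine Summable.of_norm (summable_of_sum_le (c := (C * ‖a‖ ^ q) ^ q⁻¹)
    (fun n => norm_nonneg _) fun S => ?_)
  set R := insert m S
  have hSR : S ⊆ R := Finset.subset_insert _ _
  refine (Finset.sum_le_sum_of_subset_of_nonneg hSR fun _ _ _ => norm_nonneg _).trans ?_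
  rw [Real.le_rpow_inv_iff_of_pos (Finset.sum_nonneg fun _ _ => norm_nonneg _)
    (by positivity) hq]
  set b : ℤ → ℝ := fun n => SignType.sign (k (m - n)) * ‖a n‖ with hb
  have h1 := hk R b
  have h2 : ∑ n ∈ R, ‖(k (m - n) : ℂ) * a n‖ = |∑ n ∈ R, k (m - n) * b n| := by
    have : ∀ n, k (m - n) * b n = ‖(k (m - n) : ℂ) * a n‖ := by
      intro n
      rw [norm_mul, Complex.norm_real, Real.norm_eq_abs, ← sign_mul_self, hb]
      ring
    simp only [this]
    rw [abs_of_nonneg (Finset.sum_nonneg fun _ _ => norm_nonneg _)]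
  rw [h2]
  have h3 : |∑ n ∈ R, k (m - n) * b n| ^ q ≤ ∑ i ∈ R, |∑ n ∈ R, k (i - n) * b n| ^ q :=
    Finset.single_le_sum (f := fun i => |∑ n ∈ R, k (i - n) * b n| ^ q)
      (fun i _ => by positivity) (Finset.mem_insert_self m S)
  refine h3.trans (h1.trans (mul_le_mul_of_nonneg_left ?_ hC))
  refine le_trans ?_ (lp.sum_rpow_le_norm_rpow hq a R)
  refine Finset.sum_le_sum fun n _ => Real.rpow_le_rpow (abs_nonneg _) ?_ hq.le
  rw [hb]
  dsimp only
  rw [abs_mul, abs_norm]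
  refine mul_le_of_le_one_left (norm_nonneg _) ?_
  rcases lt_trichotomy (k (m - n)) 0 with h | h | h <;> simp [h]

/-- A kernel with bounded finite sections defines a bounded convolution operator on `ℓ^p`. -/
theorem ConvBounded.exists_clm {p : ℝ≥0∞} [Fact (1 ≤ p)] (hp : p ≠ ∞) {k : ℤ → ℝ}
    (hk : ConvBounded p.toReal k) :
    ∃ T : EllP p →L[ℂ] EllP p, ∀ (a : EllP p) (m : ℤ),
      HasSum (fun n => (k (m - n) : ℂ) * a n) (T a m) := by
  have hs := hk.summable hp
  obtain ⟨C, hC, hk⟩ := hk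
  have hq := toReal_pos_of_fact hp
  set q := p.toReal with hqdef
  set D := 2 ^ q * (2 * C)
  have hD : 0 ≤ D := by positivity
  have hbound : ∀ (a : EllP p) (R : Finset ℤ),
      ∑ m ∈ R, ‖∑' n, (k (m - n) : ℂ) * a n‖ ^ q ≤ D * ‖a‖ ^ q := by
    intro a R
    have hlim : Filter.Tendsto (fun S : Finset ℤ =>
        ∑ m ∈ R, ‖∑ n ∈ S, (k (m - n) : ℂ) * a n‖ ^ q) Filter.atTop
        (nhds (∑ m ∈ R, ‖∑' n, (k (m - n) : ℂ) * a n‖ ^ q)) :=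
      tendsto_finsetSum _ fun m _ => ((hs a m).hasSum.norm).rpow_const (Or.inr hq.le)
    refine le_of_tendsto hlim ?_
    filter_upwards [Filter.eventually_ge_atTop R] with S hS
    calc ∑ m ∈ R, ‖∑ n ∈ S, (k (m - n) : ℂ) * a n‖ ^ q
        ≤ ∑ m ∈ S, ‖∑ n ∈ S, (k (m - n) : ℂ) * a n‖ ^ q :=
          Finset.sum_le_sum_of_subset_of_nonneg hS fun _ _ _ => by positivity
      _ ≤ D * ∑ n ∈ S, ‖a n‖ ^ q := sum_norm_conv_rpow_le hq.le hC (hk S) a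
      _ ≤ D * ‖a‖ ^ q := by
          gcongr
          exact lp.sum_rpow_le_norm_rpow hq a S
  let L : EllP p →ₗ[ℂ] EllP p :=
    { toFun := fun a => ⟨fun m => ∑' n, (k (m - n) : ℂ) * a n, memℓp_gen' (hbound a)⟩
      map_add' := fun a b => by
        ext m
        simp only [lp.coeFn_add, Pi.add_apply, mul_add]
        exact (hs a m).tsum_add (hs b m)
      map_smul' := fun c a => by
        ext m
        simp only [lp.coeFn_smul, Pi.smul_apply, smul_eq_mul, RingHom.id_apply, mul_left_comm _ c]
        exact tsum_mul_left }
  refine ⟨L.mkContinuous (D ^ q⁻¹) fun a => ?_, fun a m => (hs a m).hasSum⟩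
  refine lp.norm_le_of_forall_sum_le hq (by positivity) fun R => (hbound a R).trans (le_of_eq ?_)
  rw [Real.mul_rpow (by positivity) (norm_nonneg _), ← hqdef, ← Real.rpow_mul hD,
    inv_mul_cancel₀ hq.ne', Real.rpow_one]

/-! ### Splitting sequences by parity -/

theorem injective_two_mul_add (r : ℤ) : Function.Injective fun n : ℤ => 2 * n + r := by
  intro m n h
  dsimp only at h
  omega

theorem HasSum.parity {E : Type*} [NormedAddCommGroup E] {f : ℤ → E} {x y : E} (r : ℤ)
    (hx : HasSum (fun n => f (2 * n + r)) x) (hy : HasSum (fun n => f (2 * n + (r + 1))) y) :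
    HasSum f (x + y) := by
  have hc : IsCompl (Set.range fun n : ℤ => 2 * n + r) (Set.range fun n : ℤ => 2 * n + (r + 1)) := by
    rw [isCompl_iff, Set.disjoint_left, codisjoint_iff_le_sup]
    refine ⟨?_, fun m _ => ?_⟩
    · rintro _ ⟨n, rfl⟩ ⟨l, h⟩
      dsimp only at h
      omega
    · rcases Int.emod_two_eq_zero_or_one (m - r) with h | h
      · exact Or.inl ⟨(m - r) / 2, by dsimp only; omega⟩
      · exact Or.inr ⟨(m - r) / 2, by dsimp only; omega⟩
  exact HasSum.add_isCompl hc ((injective_two_mul_add r).hasSum_range_iff.2 hx)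
    ((injective_two_mul_add (r + 1)).hasSum_range_iff.2 hy)

theorem tsum_even_subtype (f : ℤ → ℂ) :
    ∑' n : {n : ℤ // Even n}, f n = ∑' n : ℤ, f (2 * n + 0) := by
  refine ((Equiv.ofBijective (fun n : ℤ => (⟨2 * n + 0, by simp⟩ : {n : ℤ // Even n}))
    ⟨fun m n h => injective_two_mul_add 0 (congrArg Subtype.val h), ?_⟩).tsum_eq
      (fun n : {n : ℤ // Even n} => f n)).symm
  rintro ⟨m, k, rfl⟩
  exact ⟨k, Subtype.ext (by dsimp only; omega)⟩

theorem tsum_odd_subtype (f : ℤ → ℂ) :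
    ∑' n : {n : ℤ // Odd n}, f n = ∑' n : ℤ, f (2 * n + (-1)) := by
  refine ((Equiv.ofBijective (fun n : ℤ => (⟨2 * n + (-1), ⟨n - 1, by ring⟩⟩ : {n : ℤ // Odd n}))
    ⟨fun m n h => injective_two_mul_add (-1) (congrArg Subtype.val h), ?_⟩).tsum_eq
      (fun n : {n : ℤ // Odd n} => f n)).symm
  rintro ⟨m, k, rfl⟩
  exact ⟨k + 1, Subtype.ext (by dsimp only; omega)⟩

section Parity

variable {p : ℝ≥0∞} [Fact (1 ≤ p)]

/-- The subsequence `n ↦ a (2 n + r)` of `a ∈ ℓ^p`. -/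
def decimate (hp : p ≠ ∞) (r : ℤ) : EllP p →ₗ[ℂ] EllP p where
  toFun a := ⟨fun n => a (2 * n + r), memℓp_gen
    (((lp.memℓp a).summable (toReal_pos_of_fact hp)).comp_injective (injective_two_mul_add r))⟩
  map_add' _ _ := rfl
  map_smul' _ _ := rfl

theorem decimate_apply (hp : p ≠ ∞) (r : ℤ) (a : EllP p) (n : ℤ) :
    decimate hp r a n = a (2 * n + r) := rfl

theorem norm_rpow_parity (hp : p ≠ ∞) (r : ℤ) (a : EllP p) :
    ‖a‖ ^ p.toReal = ‖decimate hp r a‖ ^ p.toReal + ‖decimate hp (r + 1) a‖ ^ p.toReal := by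
  have hq := toReal_pos_of_fact hp
  exact (lp.hasSum_norm hq a).unique (HasSum.parity r (lp.hasSum_norm hq (decimate hp r a))
    (lp.hasSum_norm hq (decimate hp (r + 1) a)))

theorem norm_decimate_le (hp : p ≠ ∞) (r : ℤ) (a : EllP p) : ‖decimate hp r a‖ ≤ ‖a‖ := by
  have hq := toReal_pos_of_fact hp
  rw [← Real.rpow_le_rpow_iff (norm_nonneg _) (norm_nonneg _) hq, norm_rpow_parity hp r a]
  have := Real.rpow_nonneg (norm_nonneg (decimate hp (r + 1) a)) p.toReal
  linarith

theorem ext_decimate (hp : p ≠ ∞) {a b : EllP p} (r : ℤ) (h0 : decimate hp r a = decimate hp r b)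
    (h1 : decimate hp (r + 1) a = decimate hp (r + 1) b) : a = b := by
  have h := norm_rpow_parity hp r (a - b)
  have hq := toReal_pos_of_fact hp
  rw [map_sub, map_sub, h0, h1, sub_self, sub_self, norm_zero, Real.zero_rpow hq.ne', add_zero,
    Real.rpow_eq_zero (norm_nonneg _) hq.ne', norm_eq_zero] at h
  exact sub_eq_zero.1 h

/-- The sequence that equals `b n` at `2 n + r` and vanishes at the integers of the other parity. -/
def dilate (hp : p ≠ ∞) (r : ℤ) : EllP p →ₗ[ℂ] EllP p where
  toFun b := ⟨fun m => if (m - r) % 2 = 0 then b ((m - r) / 2) else 0, by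
    have hq := toReal_pos_of_fact hp
    refine memℓp_gen (HasSum.parity r (x := ‖b‖ ^ p.toReal) (y := 0) ?_ ?_).summable
    · simpa using lp.hasSum_norm hq b
    · convert hasSum_zero with n
      rw [if_neg (by omega), norm_zero, Real.zero_rpow hq.ne']⟩
  map_add' a b := by
    ext m
    change (if _ then a _ + b _ else 0) = (if _ then a _ else 0) + (if _ then b _ else 0)
    split_ifs <;> simp
  map_smul' c b := by
    ext m
    change (if _ then c * b _ else 0) = c * (if _ then b _ else 0)
    split_ifs <;> simp

theorem dilate_apply (hp : p ≠ ∞) (r : ℤ) (b : EllP p) (m : ℤ) :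
    dilate hp r b m = if (m - r) % 2 = 0 then b ((m - r) / 2) else 0 := rfl

theorem decimate_dilate_self (hp : p ≠ ∞) (r : ℤ) (b : EllP p) :
    decimate hp r (dilate hp r b) = b := by
  ext n
  simp [decimate_apply, dilate_apply]

theorem decimate_dilate_of_odd (hp : p ≠ ∞) {r s : ℤ} (h : (r - s) % 2 = 1) (b : EllP p) :
    decimate hp r (dilate hp s b) = 0 := by
  ext n
  rw [decimate_apply, dilate_apply, if_neg (by omega)]
  rfl

theorem norm_dilate (hp : p ≠ ∞) (r : ℤ) (b : EllP p) : ‖dilate hp r b‖ = ‖b‖ := by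
  have hq := toReal_pos_of_fact hp
  have h := norm_rpow_parity hp r (dilate hp r b)
  rw [decimate_dilate_self, decimate_dilate_of_odd hp (by omega), norm_zero,
    Real.zero_rpow hq.ne', add_zero] at h
  exact (Real.rpow_left_inj (norm_nonneg _) (norm_nonneg _) hq.ne').1 h

/-- Up to isometric relabelling of the source and of the target, the operator obtained here is the
direct sum of two copies of `X` on `ℓ^p ⊕ ℓ^p`, and therefore has the norm of `X`. -/
theorem exists_interleave (hp : p ≠ ∞) (X : EllP p →L[ℂ] EllP p) (r : ℤ) :
    ∃ Y : EllP p →L[ℂ] EllP p, ‖Y‖ = ‖X‖ ∧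
      (∀ a, decimate hp 0 (Y a) = X (decimate hp r a)) ∧
      ∀ a, decimate hp 1 (Y a) = X (decimate hp (r + 1) a) := by
  have hq := toReal_pos_of_fact hp
  let L : EllP p →ₗ[ℂ] EllP p :=
    dilate hp 0 ∘ₗ X.toLinearMap ∘ₗ decimate hp r +
      dilate hp 1 ∘ₗ X.toLinearMap ∘ₗ decimate hp (r + 1)
  have hL0 : ∀ a, decimate hp 0 (L a) = X (decimate hp r a) := fun a => by
    simp [L, decimate_dilate_self, decimate_dilate_of_odd hp (r := 0) (s := 1) (by norm_num)]
  have hL1 : ∀ a, decimate hp 1 (L a) = X (decimate hp (r + 1) a) := fun a => by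
    simp [L, decimate_dilate_self, decimate_dilate_of_odd hp (r := 1) (s := 0) (by norm_num)]
  have hbound : ∀ a, ‖L a‖ ≤ ‖X‖ * ‖a‖ := by
    intro a
    rw [← Real.rpow_le_rpow_iff (norm_nonneg _) (by positivity) hq, norm_rpow_parity hp 0 (L a),
      zero_add, hL0, hL1, Real.mul_rpow (norm_nonneg _) (norm_nonneg _), norm_rpow_parity hp r a,
      mul_add, ← Real.mul_rpow (norm_nonneg _) (norm_nonneg _),
      ← Real.mul_rpow (norm_nonneg _) (norm_nonneg _)]
    gcongr <;> exact X.le_opNorm _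
  refine ⟨L.mkContinuous ‖X‖ hbound, le_antisymm
    (L.mkContinuous_norm_le (norm_nonneg _) hbound) ?_, hL0, hL1⟩
  refine ContinuousLinearMap.opNorm_le_bound _ (norm_nonneg _) fun b => ?_
  have h0 : X b = decimate hp 0 (L.mkContinuous ‖X‖ hbound (dilate hp r b)) := by
    rw [LinearMap.mkContinuous_apply, hL0, decimate_dilate_self]
  rw [h0]
  refine (norm_decimate_le hp 0 _).trans ((ContinuousLinearMap.le_opNorm _ _).trans ?_)
  rw [norm_dilate]

end Parity

/-! ### Identification of the entries -/

section Entries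

variable {p : ℝ≥0∞} [Fact (1 ≤ p)]

theorem discreteHilbert_eq {U : EllP p →L[ℂ] EllP p}
    (hU : ∀ (a : EllP p) (m : ℤ),
      HasSum (fun n => ((1 / ((m - n : ℤ) : ℝ) : ℝ) : ℂ) * a n) (U a m)) (a : EllP p) (m : ℤ) :
    discreteHilbert a m = 1 / (Real.pi : ℂ) * U a m := by
  rw [discreteHilbert]
  congr 1
  refine HasSum.tsum_eq ?_
  -- the term `n = m` of the full sum is `1 / 0 * a m = 0`
  have h := (Subtype.val_injective (p := fun n : ℤ => n ≠ m)).hasSum_iff (a := U a m)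
    (f := fun n => ((1 / ((m - n : ℤ) : ℝ) : ℝ) : ℂ) * a n) (fun n hn => by
      have : n = m := by
        by_contra h
        exact hn ⟨⟨n, h⟩, rfl⟩
      simp [this])
  refine (h.2 (hU a m)).congr_fun ?_
  intro n
  simp [div_eq_inv_mul]

theorem discreteT_half_eq {V : EllP p →L[ℂ] EllP p}
    (hV : ∀ (a : EllP p) (m : ℤ),
      HasSum (fun n => ((1 / (((m - n : ℤ) : ℝ) + 1 / 2) : ℝ) : ℂ) * a n) (V a m))
    (a : EllP p) (m : ℤ) :
    discreteT (1 / 2) a m = 1 / (Real.pi : ℂ) * V a m := by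
  have hfl : ⌊(1 / 2 : ℝ)⌋ = 0 := by norm_num
  rw [discreteT, if_neg (by rw [hfl]; norm_num), ← (hV a m).tsum_eq]
  congr 1
  · rw [mul_one_div, Real.sin_pi_div_two]
    push_cast
    rfl
  · refine tsum_congr fun n => ?_
    push_cast
    rw [one_div_mul_eq_div]

/-- For even `m = 2 l` the odd integers `n = 2 j - 1` enter, and
`m - n = 2 (l - j + 1 / 2)`. -/
theorem kakHilbert_two_mul (hp : p ≠ ∞) {V : EllP p →L[ℂ] EllP p}
    (hV : ∀ (a : EllP p) (m : ℤ),
      HasSum (fun n => ((1 / (((m - n : ℤ) : ℝ) + 1 / 2) : ℝ) : ℂ) * a n) (V a m))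
    (a : EllP p) (l : ℤ) :
    kakHilbert a (2 * l) = 1 / (Real.pi : ℂ) * V (decimate hp (-1) a) l := by
  rw [kakHilbert, if_neg (by simp), ← (hV _ l).tsum_eq,
    tsum_odd_subtype fun n => a n / (((2 * l : ℤ) : ℂ) - (n : ℂ)), ← tsum_mul_left, ← tsum_mul_left]
  refine tsum_congr fun n => ?_
  rw [decimate_apply]
  push_cast
  have e : (2 * (l : ℂ) - (2 * n + -1)) = 2 * (l - n + 1 / 2) := by ring
  rw [e, div_eq_mul_inv _ (2 * _), mul_inv]
  ring

/-- For odd `m = 2 l + 1` the even integers `n = 2 j` enter, and `m - n = 2 (l - j + 1 / 2)`. -/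
theorem kakHilbert_two_mul_add_one (hp : p ≠ ∞) {V : EllP p →L[ℂ] EllP p}
    (hV : ∀ (a : EllP p) (m : ℤ),
      HasSum (fun n => ((1 / (((m - n : ℤ) : ℝ) + 1 / 2) : ℝ) : ℂ) * a n) (V a m))
    (a : EllP p) (l : ℤ) :
    kakHilbert a (2 * l + 1) = 1 / (Real.pi : ℂ) * V (decimate hp 0 a) l := by
  rw [kakHilbert, if_pos ⟨l, rfl⟩, ← (hV _ l).tsum_eq,
    tsum_even_subtype fun n => a n / (((2 * l + 1 : ℤ) : ℂ) - (n : ℂ)), ← tsum_mul_left,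
    ← tsum_mul_left]
  refine tsum_congr fun n => ?_
  rw [decimate_apply]
  push_cast
  have e : (2 * (l : ℂ) + 1 - (2 * n + 0)) = 2 * (l - n + 1 / 2) := by ring
  rw [e, div_eq_mul_inv _ (2 * _), mul_inv]
  ring

/-- Splitting of `∑ a_n / (2 l - n)` into even and odd `n`. -/
theorem two_mul_hilbert_two_mul (hp : p ≠ ∞) {U V : EllP p →L[ℂ] EllP p}
    (hU : ∀ (a : EllP p) (m : ℤ),
      HasSum (fun n => ((1 / ((m - n : ℤ) : ℝ) : ℝ) : ℂ) * a n) (U a m))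
    (hV : ∀ (a : EllP p) (m : ℤ),
      HasSum (fun n => ((1 / (((m - n : ℤ) : ℝ) + 1 / 2) : ℝ) : ℂ) * a n) (V a m))
    (a : EllP p) (l : ℤ) :
    2 * U a (2 * l) = V (decimate hp (-1) a) l + U (decimate hp 0 a) l := by
  refine ((hU a (2 * l)).mul_left 2).unique (HasSum.parity (-1) ?_ ?_)
  · refine (hV (decimate hp (-1) a) l).congr_fun fun n => ?_
    rw [decimate_apply, ← mul_assoc]
    congr 1
    push_cast
    rw [show (2 * (l : ℂ) - (2 * n + -1)) = 2 * (l - n + 1 / 2) by ring, one_div, mul_inv]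
    ring
  · refine (hU (decimate hp 0 a) l).congr_fun fun n => ?_
    rw [decimate_apply, ← mul_assoc]
    congr 1
    push_cast
    rw [show (2 * (l : ℂ) - (2 * n + 0)) = 2 * (l - n) by ring, one_div, mul_inv]
    ring

theorem two_mul_hilbert_two_mul_add_one (hp : p ≠ ∞) {U V : EllP p →L[ℂ] EllP p}
    (hU : ∀ (a : EllP p) (m : ℤ),
      HasSum (fun n => ((1 / ((m - n : ℤ) : ℝ) : ℝ) : ℂ) * a n) (U a m))
    (hV : ∀ (a : EllP p) (m : ℤ),
      HasSum (fun n => ((1 / (((m - n : ℤ) : ℝ) + 1 / 2) : ℝ) : ℂ) * a n) (V a m))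
    (a : EllP p) (l : ℤ) :
    2 * U a (2 * l + 1) = V (decimate hp 0 a) l + U (decimate hp 1 a) l := by
  refine ((hU a (2 * l + 1)).mul_left 2).unique (HasSum.parity 0 ?_ ?_)
  · refine (hV (decimate hp 0 a) l).congr_fun fun n => ?_
    rw [decimate_apply, ← mul_assoc]
    congr 1
    push_cast
    rw [show (2 * (l : ℂ) + 1 - (2 * n + 0)) = 2 * (l - n + 1 / 2) by ring, one_div, mul_inv]
    ring
  · refine (hU (decimate hp 1 a) l).congr_fun fun n => ?_
    rw [decimate_apply, ← mul_assoc]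
    congr 1
    push_cast
    rw [show (2 * (l : ℂ) + 1 - (2 * n + 1)) = 2 * (l - n) by ring, one_div, mul_inv]
    ring

end Entries

/-- The operators `H`, `K`, `T_{1/2}` are bounded on `ℓ^p` (they are the continuous linear maps
`H`, `K`, `T` below, uniquely determined by their entries), and the norms are those of
`ℓ^p →L[ℂ] ℓ^p`. The operator `K̃` is `2 H - K`. -/
theorem theorem3p2 (p : ℝ≥0∞) [Fact (1 ≤ p)] (hp_one : 1 < p) (hp_top : p ≠ ∞) :
    ∃ H K T : EllP p →L[ℂ] EllP p,
      (∀ (a : EllP p) (m : ℤ), H a m = discreteHilbert a m) ∧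
      (∀ (a : EllP p) (m : ℤ), K a m = kakHilbert a m) ∧
      (∀ (a : EllP p) (m : ℤ), T a m = discreteT (1 / 2) a m) ∧
      ‖(2 : ℂ) • H - K‖ = ‖H‖ ∧
      ‖H‖ ≤ ‖K‖ ∧
      ‖K‖ = ‖T‖ := by
  have hq : 1 < p.toReal := by
    rw [← ENNReal.toReal_one]
    exact (ENNReal.toReal_lt_toReal ENNReal.one_ne_top hp_top).2 hp_one
  obtain ⟨U, hU⟩ := (convBounded_one_div hq).exists_clm hp_top
  obtain ⟨V, hV⟩ := (convBounded_one_div_add_half hq).exists_clm hp_top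
  set H : EllP p →L[ℂ] EllP p := (1 / (Real.pi : ℂ)) • U with hH
  set T : EllP p →L[ℂ] EllP p := (1 / (Real.pi : ℂ)) • V with hT
  have hHm : ∀ a m, H a m = 1 / (Real.pi : ℂ) * U a m := fun _ _ => rfl
  have hTm : ∀ a m, T a m = 1 / (Real.pi : ℂ) * V a m := fun _ _ => rfl
  obtain ⟨K, hK, hK0, hK1⟩ := exists_interleave hp_top T (-1)
  obtain ⟨L, hL, hL0, hL1⟩ := exists_interleave hp_top H 0
  have hKe : ∀ a l, K a (2 * l) = 1 / (Real.pi : ℂ) * V (decimate hp_top (-1) a) l := by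
    intro a l
    rw [← hTm, ← hK0, decimate_apply, add_zero]
  have hKo : ∀ a l, K a (2 * l + 1) = 1 / (Real.pi : ℂ) * V (decimate hp_top 0 a) l := by
    intro a l
    rw [← hTm, ← neg_add_cancel (1 : ℤ), ← hK1, decimate_apply]
  -- `L` is the operator `K̃`
  have hKL : (2 : ℂ) • H - K = L := by
    rw [sub_eq_iff_eq_add']
    ext a : 1
    refine ext_decimate hp_top 0 ?_ ?_
    · ext l
      have h := two_mul_hilbert_two_mul hp_top hU hV a l
      have h0 : L a (2 * l) = H (decimate hp_top 0 a) l := by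
        rw [← hL0, decimate_apply, add_zero]
      change 2 * H a (2 * l + 0) = K a (2 * l + 0) + L a (2 * l + 0)
      rw [add_zero, hKe, h0, hHm, hHm]
      linear_combination (1 / (Real.pi : ℂ)) * h
    · ext l
      have h := two_mul_hilbert_two_mul_add_one hp_top hU hV a l
      have h0 : L a (2 * l + 1) = H (decimate hp_top 1 a) l := by
        rw [← zero_add (1 : ℤ), ← hL1, decimate_apply, zero_add]
      change 2 * H a (2 * l + (0 + 1)) = K a (2 * l + (0 + 1)) + L a (2 * l + (0 + 1))
      rw [zero_add, hKo, h0, hHm, hHm]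
      linear_combination (1 / (Real.pi : ℂ)) * h
  refine ⟨H, K, T, fun a m => ?_, fun a m => ?_, fun a m => ?_, ?_, ?_, hK⟩
  · rw [discreteHilbert_eq hU, hHm]
  · obtain ⟨l, rfl | rfl⟩ := Int.even_or_odd' m
    · rw [kakHilbert_two_mul hp_top hV, hKe]
    · rw [kakHilbert_two_mul_add_one hp_top hV, hKo]
  · rw [discreteT_half_eq hV, hTm]
  · rw [hKL, hL]
  · -- `2 H = K + K̃` and `‖K̃‖ = ‖H‖` give `2 ‖H‖ ≤ ‖K‖ + ‖H‖`
    have h := norm_add_le K L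
    rw [← hKL, add_sub_cancel, norm_smul, hKL, hL, Complex.norm_ofNat] at h
    linarith
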